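/- Let $(\mathcal T,\otimes,\mathbb 1)$ be a monoidal triangulated category, i.e. a triangulated category with a monoidal structure whose tensor product is exact (triangulated) in each variable, and let $\mathcal K$ be a left triangulated module category over $\mathcal T$, i.e. a triangulated category with a left $\mathcal T$-module category structure $\otimes:\mathcal T\times\mathcal K\to\mathcal K$ that is exact in each variable. A t-structure $(\mathcal D^{\le 0},\mathcal D^{\ge 0})$ on a triangulated category $\mathcal D$, with $\mathcal D^{\le n}=\mathcal D^{\le 0}[-n]$ and $\mathcal D^{\ge n}=\mathcal D^{\ge 0}[-n]$, is bounded if $\bigcup_{n}\mathcal D^{\le n}=\bigcup_{n}\mathcal D^{\ge n}=\mathcal D$; its heart is $\mathcal D^{\le 0}\cap\mathcal D^{\ge 0}$. Let $\mathbb t=(\mathcal T^{\le 0},\mathcal T^{\ge 0})$ be a monoidal t-structure on $\mathcal T$, i.e. a bounded t-structure whose deviation $$\operatorname{dev}(\mathbb t)=\{n\in\mathbb Z\mid \mathcal T^{\le 0}\otimes\mathcal T^{\le n}\subseteq\mathcal T^{\le 0},\ \mathcal T^{\ge 0}\otimes\mathcal T^{\ge n}\subseteq\mathcal T^{\ge 0}\}$$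 is nonempty, and let $\mathbb t'=(\mathcal K^{\le 0},\mathcal K^{\ge 0})$ be a triangulated module t-structure on $\mathcal K$ with respect to $\mathbb t$, i.e. a bounded t-structure whose deviation $$\operatorname{dev}_{\mathbb t}(\mathbb t')=\{m\in\mathbb Z\mid \mathcal T^{\le 0}\otimes\mathcal K^{\le m}\subseteq\mathcal K^{\le 0},\ \mathcal T^{\ge 0}\otimes\mathcal K^{\ge m}\subseteq\mathcal K^{\ge 0}\}$$ is nonempty. Suppose that $0\in\operatorname{dev}(\mathbb t)$ and $0\in\operatorname{dev}_{\mathbb t}(\mathbb t')$. Then the heart $\mathcal H_{\mathbb t}$ is a monoidal category under $\otimes$ and the heart $\mathcal H_{\mathbb t'}$ is a left module category over it, with the structures restricted from $\mathcal T$ and $\mathcal K$. Call a left module category $\mathcal M$ over a monoidal category $\mathcal C$ faithful if every nonzero object $X$ of $\mathcal C$ acts by a nonzero functor $X\otimes -:\mathcal M\to\mathcal M$. Then $\mathcal K$ is faithful as a $\mathcal T$-module category if and only if $\mathcal H_{\mathbb t'}$ is faithful as an $\mathcal H_{\mathbb t}$-module category. -/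

import Mathlib

open CategoryTheory CategoryTheory.Limits CategoryTheory.Triangulated
open CategoryTheory.Pretriangulated CategoryTheory.MonoidalCategory
open CategoryTheory.MonoidalCategory.MonoidalLeftAction

namespace TriangModule

universe v u v' u'

section Exactness

variable {C : Type u} [Category.{v} C] [HasZeroObject C] [HasShift C ℤ] [Preadditive C]
  [∀ n : ℤ, (shiftFunctor C n).Additive] [Pretriangulated C]
  {D : Type u'} [Category.{v'} D] [HasZeroObject D] [HasShift D ℤ] [Preadditive D]
  [∀ n : ℤ, (shiftFunctor D n).Additive] [Pretriangulated D]

/-- A functor between triangulated categories is exact (triangulated) if, for some natural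
isomorphism with the shifts, it sends distinguished triangles to distinguished triangles. -/
def IsExact (F : C ⥤ D) : Prop :=
  ∃ _ : F.CommShift ℤ, F.IsTriangulated

/-- A t-structure is bounded if every object is `≤ n` for some `n` and `≥ m` for some `m`. -/
def IsBounded (t : TStructure C) : Prop :=
  ∀ X : C, t.bounded X

/-- Exact functors send distinguished triangles to distinguished triangles, with the evident
first two morphisms. -/
lemma IsExact.map_triangle {F : C ⥤ D} (hF : IsExact F) {X Y Z : C} {f : X ⟶ Y} {g : Y ⟶ Z}
    {h : Z ⟶ X⟦(1 : ℤ)⟧} (hT : Triangle.mk f g h ∈ distTriang C) :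
    ∃ h' : F.obj Z ⟶ (F.obj X)⟦(1 : ℤ)⟧, Triangle.mk (F.map f) (F.map g) h' ∈ distTriang D := by
  obtain ⟨_, _⟩ := hF
  exact ⟨_, F.map_distinguished _ hT⟩

/-- Exact functors commute with shifts. -/
lemma IsExact.map_shift {F : C ⥤ D} (hF : IsExact F) (X : C) (n : ℤ) :
    Nonempty (F.obj (X⟦n⟧) ≅ (F.obj X)⟦n⟧) := by
  obtain ⟨_, _⟩ := hF
  exact ⟨(F.commShiftIso n).app X⟩

lemma IsExact.le_add {F : C ⥤ D} (hF : IsExact F) (t : TStructure C) (t' : TStructure D)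
    {a b : ℤ} (h : ∀ X, t.le a X → t'.le b (F.obj X)) (k : ℤ) (X : C) (hX : t.le (a + k) X) :
    t'.le (b + k) (F.obj X) := by
  have h1 := h _ (t.le_shift (a + k) k a (by lia) X hX)
  obtain ⟨e⟩ := hF.map_shift X k
  have h2 := (t'.le b).prop_of_iso e h1
  have : t'.IsLE ((F.obj X)⟦k⟧) b := ⟨h2⟩
  exact (t'.isLE_of_shift (F.obj X) (b + k) k b (by lia)).le

lemma IsExact.ge_add {F : C ⥤ D} (hF : IsExact F) (t : TStructure C) (t' : TStructure D)
    {a b : ℤ} (h : ∀ X, t.ge a X → t'.ge b (F.obj X)) (k : ℤ) (X : C) (hX : t.ge (a + k) X) :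
    t'.ge (b + k) (F.obj X) := by
  have h1 := h _ (t.ge_shift (a + k) k a (by lia) X hX)
  obtain ⟨e⟩ := hF.map_shift X k
  have h2 := (t'.ge b).prop_of_iso e h1
  have : t'.IsGE ((F.obj X)⟦k⟧) b := ⟨h2⟩
  exact (t'.isGE_of_shift (F.obj X) (b + k) k b (by lia)).ge

/-- The third object of a triangle whose other two objects are `≤ n` is `≤ n`. -/
lemma le_third (t : TStructure C) {X Y Z : C} {f : X ⟶ Y} {g : Y ⟶ Z} {h : Z ⟶ X⟦(1 : ℤ)⟧}
    (hT : Triangle.mk f g h ∈ distTriang C) (n : ℤ) (hX : t.le (n + 1) X) (hY : t.le n Y) :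
    t.le n Z :=
  (t.isLE₂ _ (rot_of_distTriang _ hT) n ⟨hY⟩ ⟨t.le_shift (n + 1) 1 n (by lia) X hX⟩).le

/-- The first object of a triangle whose other two objects are `≥ n` is `≥ n`. -/
lemma ge_first (t : TStructure C) {X Y Z : C} {f : X ⟶ Y} {g : Y ⟶ Z} {h : Z ⟶ X⟦(1 : ℤ)⟧}
    (hT : Triangle.mk f g h ∈ distTriang C) (n : ℤ) (hZ : t.ge (n - 1) Z) (hY : t.ge n Y) :
    t.ge n X :=
  (t.isGE₂ _ (inv_rot_of_distTriang _ hT) n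
    ⟨t.ge_shift (n - 1) (-1) n (by lia) Z hZ⟩ ⟨hY⟩).ge

/-- An exact functor vanishing on the heart of a bounded t-structure vanishes. -/
lemma IsExact.isZero_of_heart {F : C ⥤ D} (hF : IsExact F) (t : TStructure C) (ht : IsBounded t)
    (h : ∀ X, t.heart X → IsZero (F.obj X)) (X : C) : IsZero (F.obj X) := by
  have key : ∀ (k : ℕ) (X : C), t.le 0 X → t.ge (-(k : ℤ)) X → IsZero (F.obj X) := by
    intro k
    induction k with
    | zero => exact fun X h0 h1 => h X ⟨h0, by simpa using h1⟩
    | succ k ih =>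
      intro X h0 h1
      obtain ⟨U, V, hU, hV, f, g, w, hT⟩ := t.exists_triangle X (-1) 0 (by lia)
      have hV0 : t.le 0 V := le_third t hT 0 (t.le_monotone (by lia) _ hU) h0
      have hU0 : t.ge (-((k + 1 : ℕ) : ℤ)) U :=
        ge_first t hT _ (t.ge_antitone (by lia) _ hV) h1
      have hU' : IsZero (F.obj (U⟦(-1 : ℤ)⟧)) :=
        ih _ (t.le_shift _ _ _ (by lia) _ hU) (t.ge_shift _ _ _ (by push_cast; lia) _ hU0)
      obtain ⟨e⟩ := hF.map_shift U (-1)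
      have hFU : IsZero (F.obj U) := by
        have h2 := (shiftFunctor D (1 : ℤ)).map_isZero (hU'.of_iso e.symm)
        exact h2.of_iso ((shiftEquiv D (1 : ℤ)).counitIso.symm.app (F.obj U))
      obtain ⟨w', hT'⟩ := hF.map_triangle hT
      exact Triangle.isZero₂_of_isZero₁₃ _ hT' hFU (h V ⟨hV0, hV⟩)
  obtain ⟨⟨a, ha⟩, ⟨b, hb⟩⟩ := ht X
  have h1 : t.le 0 (X⟦b⟧) := t.le_shift b b 0 (by lia) X hb.le
  have h2 : t.ge (a - b) (X⟦b⟧) := t.ge_shift a b _ (by lia) X ha.ge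
  have h3 := key (b - a).toNat _ h1 (t.ge_antitone (by lia) _ h2)
  obtain ⟨e⟩ := hF.map_shift X b
  have h4 := (shiftFunctor D (-b)).map_isZero (h3.of_iso e.symm)
  exact h4.of_iso ((shiftEquiv D b).unitIso.app (F.obj X))

end Exactness

section ModuleCategories

variable (C : Type u) [Category.{v} C] [MonoidalCategory C]
  (M : Type u') [Category.{v'} M] [MonoidalLeftAction C M]

/-- A left module category `M` over a monoidal category `C` is faithful if every nonzero object
`X` of `C` acts by a nonzero functor `X ⊙ₗ - : M ⥤ M`. -/
def IsFaithfulModuleCategory : Prop :=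
  ∀ X : C, ¬ IsZero X → ¬ IsZero (actionLeft M X)

variable {C M}

/-- If a property of objects `Q` of a module category is stable under the action of the objects
of a monoidal property `P`, the module category structure restricts to the corresponding full
subcategories. -/
@[reducible]
def restrictedAction (P : ObjectProperty C) [P.IsMonoidal] (Q : ObjectProperty M)
    (h : ∀ (X : C) (N : M), P X → Q N → Q (X ⊙ₗ N)) :
    MonoidalLeftAction P.FullSubcategory Q.FullSubcategory where
  actionObj X N := ⟨X.obj ⊙ₗ N.obj, h _ _ X.property N.property⟩
  actionHomLeft f N := ObjectProperty.homMk (f.hom ⊵ₗ N.obj)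
  actionHomRight X _ _ g := ObjectProperty.homMk (X.obj ⊴ₗ g.hom)
  actionHom f g := ObjectProperty.homMk (f.hom ⊙ₗₘ g.hom)
  actionAssocIso X Y N := Q.isoMk (αₗ X.obj Y.obj N.obj)
  actionUnitIso N := Q.isoMk (λₗ N.obj)
  actionHom_def f g := by
    ext
    exact actionHom_def f.hom g.hom
  actionAssocIso_hom_naturality f g k := by
    ext
    exact actionAssocIso_hom_naturality f.hom g.hom k.hom

end ModuleCategories

variable (T : Type u) [Category.{v} T] [HasZeroObject T] [HasShift T ℤ] [Preadditive T]
  [∀ n : ℤ, (shiftFunctor T n).Additive] [Pretriangulated T] [MonoidalCategory T]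
  (K : Type u') [Category.{v'} K] [HasZeroObject K] [HasShift K ℤ] [Preadditive K]
  [∀ n : ℤ, (shiftFunctor K n).Additive] [Pretriangulated K] [MonoidalLeftAction T K]

/-- A monoidal triangulated category: a triangulated category with a monoidal structure whose
tensor product is exact in each variable. -/
class IsMonoidalTriangulated : Prop where
  exact_tensorLeft (X : T) : IsExact (tensorLeft X)
  exact_tensorRight (X : T) : IsExact (tensorRight X)

/-- A left triangulated module category over `T`: a triangulated category with a left module
category structure over `T` whose module product is exact in each variable. -/
class IsTriangulatedModule : Prop where
  exact_actionLeft (X : T) : IsExact (actionLeft K X)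
  exact_actionRight (M : K) : IsExact (actionRight T M)

variable {T K}

/-- The deviation of a t-structure on a monoidal triangulated category. -/
def dev (t : TStructure T) : Set ℤ :=
  {n | (∀ X Y : T, t.le 0 X → t.le n Y → t.le 0 (X ⊗ Y)) ∧
    (∀ X Y : T, t.ge 0 X → t.ge n Y → t.ge 0 (X ⊗ Y))}

/-- A monoidal t-structure: a bounded t-structure with nonempty deviation. -/
structure IsMonoidalTStructure (t : TStructure T) : Prop where
  bounded : IsBounded t
  dev_nonempty : (dev t).Nonempty

/-- The deviation of a t-structure on a module category with respect to a t-structure on the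
acting category. -/
def moduleDev (t : TStructure T) (t' : TStructure K) : Set ℤ :=
  {m | (∀ (X : T) (M : K), t.le 0 X → t'.le m M → t'.le 0 (X ⊙ₗ M)) ∧
    (∀ (X : T) (M : K), t.ge 0 X → t'.ge m M → t'.ge 0 (X ⊙ₗ M))}

/-- A triangulated module t-structure with respect to `t`: a bounded t-structure with nonempty
deviation with respect to `t`. -/
structure IsModuleTStructure (t : TStructure T) (t' : TStructure K) : Prop where
  bounded : IsBounded t'
  dev_nonempty : (moduleDev t t').Nonempty

section HeartMonoidal

variable [IsMonoidalTriangulated T] {t : TStructure T}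

lemma tensor_le (h0 : (0 : ℤ) ∈ dev t) (p q : ℤ) (X Y : T) (hX : t.le p X) (hY : t.le q Y) :
    t.le (p + q) (X ⊗ Y) := by
  have h1 : ∀ X Y : T, t.le 0 X → t.le q Y → t.le q (X ⊗ Y) := fun X Y hX hY => by
    simpa using (IsMonoidalTriangulated.exact_tensorLeft X).le_add t t (a := 0) (b := 0)
      (fun Z hZ => h0.1 X Z hX hZ) q Y (by simpa using hY)
  have h2 := (IsMonoidalTriangulated.exact_tensorRight Y).le_add t t (a := 0) (b := q)
      (fun Z hZ => h1 Z Y hZ hY) p X (by simpa using hX)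
  simpa [add_comm] using h2

lemma tensor_ge (h0 : (0 : ℤ) ∈ dev t) (p q : ℤ) (X Y : T) (hX : t.ge p X) (hY : t.ge q Y) :
    t.ge (p + q) (X ⊗ Y) := by
  have h1 : ∀ X Y : T, t.ge 0 X → t.ge q Y → t.ge q (X ⊗ Y) := fun X Y hX hY => by
    simpa using (IsMonoidalTriangulated.exact_tensorLeft X).ge_add t t (a := 0) (b := 0)
      (fun Z hZ => h0.2 X Z hX hZ) q Y (by simpa using hY)
  have h2 := (IsMonoidalTriangulated.exact_tensorRight Y).ge_add t t (a := 0) (b := q)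
      (fun Z hZ => h1 Z Y hZ hY) p X (by simpa using hX)
  simpa [add_comm] using h2

/-- An object annihilated by all objects of the heart is zero. -/
lemma isZero_of_heart_tensor (hb : IsBounded t) (Z : T)
    (h : ∀ X : T, t.heart X → IsZero (X ⊗ Z)) : IsZero Z :=
  ((IsMonoidalTriangulated.exact_tensorRight Z).isZero_of_heart t hb h (𝟙_ T)).of_iso
    (λ_ Z).symm

lemma unit_le (hb : IsBounded t) (h0 : (0 : ℤ) ∈ dev t) : t.le 0 (𝟙_ T) := by
  have key : ∀ k : ℕ, t.le (k : ℤ) (𝟙_ T) → t.le 0 (𝟙_ T) := by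
    intro k
    induction k with
    | zero => simp
    | succ k ih =>
      intro hk
      obtain ⟨U, V, hU, hV, f, g, w, hT⟩ := t.exists_triangle (𝟙_ T) k (k + 1) rfl
      apply ih
      have hV' : IsZero V := isZero_of_heart_tensor hb V fun X hX => by
        obtain ⟨w', hT'⟩ := (IsMonoidalTriangulated.exact_tensorLeft X).map_triangle hT
        have h1 : t.le (k : ℤ) (X ⊗ U) := by simpa using tensor_le h0 0 _ X U hX.1 hU
        have h2 : t.ge (k + 1 : ℤ) (X ⊗ V) := by simpa using tensor_ge h0 0 _ X V hX.2 hV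
        have h3 : t.le (k : ℤ) (X ⊗ 𝟙_ T) :=
          (t.le k).prop_of_iso (ρ_ X).symm (t.le_monotone (by lia) _ hX.1)
        have h4 : t.le (k : ℤ) (X ⊗ V) :=
          le_third t hT' k (t.le_monotone (by lia) _ h1) h3
        have : t.IsLE (X ⊗ V) k := ⟨h4⟩
        have : t.IsGE (X ⊗ V) (k + 1) := ⟨h2⟩
        exact t.isZero (X ⊗ V) k (k + 1)
      have := (Triangle.isZero₃_iff_isIso₁ _ hT).1 hV'
      exact (t.le k).prop_of_iso (@asIso _ _ _ _ f this) hU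
  obtain ⟨-, ⟨b, hb'⟩⟩ := hb (𝟙_ T)
  exact key b.toNat (t.le_monotone (by lia) _ hb'.le)

lemma unit_ge (hb : IsBounded t) (h0 : (0 : ℤ) ∈ dev t) : t.ge 0 (𝟙_ T) := by
  have key : ∀ k : ℕ, t.ge (-(k : ℤ)) (𝟙_ T) → t.ge 0 (𝟙_ T) := by
    intro k
    induction k with
    | zero => simp
    | succ k ih =>
      intro hk
      obtain ⟨U, V, hU, hV, f, g, w, hT⟩ := t.exists_triangle (𝟙_ T) (-k - 1) (-k) (by lia)
      apply ih
      have hU' : IsZero U := isZero_of_heart_tensor hb U fun X hX => by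
        obtain ⟨w', hT'⟩ := (IsMonoidalTriangulated.exact_tensorLeft X).map_triangle hT
        have h1 : t.le (-k - 1 : ℤ) (X ⊗ U) := by simpa using tensor_le h0 0 _ X U hX.1 hU
        have h2 : t.ge (-k : ℤ) (X ⊗ V) := by simpa using tensor_ge h0 0 _ X V hX.2 hV
        have h3 : t.ge (-k : ℤ) (X ⊗ 𝟙_ T) :=
          (t.ge (-k)).prop_of_iso (ρ_ X).symm (t.ge_antitone (by lia) _ hX.2)
        have h4 : t.ge (-k : ℤ) (X ⊗ U) :=
          ge_first t hT' (-k) (t.ge_antitone (by lia) _ h2) h3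
        have : t.IsLE (X ⊗ U) (-k - 1) := ⟨h1⟩
        have : t.IsGE (X ⊗ U) (-k) := ⟨h4⟩
        exact t.isZero (X ⊗ U) (-k - 1) (-k)
      have := (Triangle.isZero₁_iff_isIso₂ _ hT).1 hU'
      exact (t.ge (-k)).prop_of_iso (@asIso _ _ _ _ g this).symm hV
  obtain ⟨⟨a, ha⟩, -⟩ := hb (𝟙_ T)
  exact key (-a).toNat (t.ge_antitone (by lia) _ ha.ge)

/-- The heart of a monoidal t-structure with `0` in its deviation contains the unit and is closed
under tensor products, hence is a monoidal category. -/
theorem heart_isMonoidal (ht : IsMonoidalTStructure t) (h0 : (0 : ℤ) ∈ dev t) :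
    t.heart.IsMonoidal where
  prop_unit := ⟨unit_le ht.bounded h0, unit_ge ht.bounded h0⟩
  prop_tensor X Y hX hY := ⟨h0.1 X Y hX.1 hY.1, h0.2 X Y hX.2 hY.2⟩

end HeartMonoidal

/-- The heart of a triangulated module t-structure with `0` in its deviation, as a left module
category over the heart of `t`: both carry the restrictions of the structures on `T` and `K`. -/
@[reducible]
def heartAction {t : TStructure T} {t' : TStructure K} [t.heart.IsMonoidal]
    (h0' : (0 : ℤ) ∈ moduleDev t t') :
    MonoidalLeftAction t.heart.FullSubcategory t'.heart.FullSubcategory :=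
  restrictedAction t.heart t'.heart fun X M hX hM =>
    ⟨h0'.1 X M hX.1 hM.1, h0'.2 X M hX.2 hM.2⟩

end TriangModule

namespace TriangModule

universe v u v' u'

/-! A functor into a category with zero morphisms is zero exactly when its values are, so
faithfulness is a statement about which objects annihilate which.

If `X` in the heart of `t` annihilates the heart of `t'`, then `X ⊙ₗ -` is exact and `t'` is
bounded, so by dévissage along truncation triangles (`IsExact.isZero_of_heart`) it annihilates all
of `K`.

Conversely, let a nonzero `X` annihilate `K`. Being bounded, it has a top nonzero cohomology `V`, in
degree `n`, with a triangle `U ⟶ X ⟶ V` and `U` in degrees `≤ n - 1`. For `M` in the heart of `t'`,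
`X ⊙ₗ M = 0` forces `V ⊙ₗ M ≅ (U ⊙ₗ M)⟦1⟧`. Deviation `0` puts the left side in degrees `≥ n` and
the right side in degrees `≤ n - 2`, so both vanish. Hence `V⟦n⟧` is a nonzero object of the heart
of `t` annihilating the heart of `t'` (`exists_heart_annihilator`). -/

lemma isZero_fullSubcategory_iff {C : Type u} [Category.{v} C] [Preadditive C]
    (P : ObjectProperty C) (X : P.FullSubcategory) : IsZero X ↔ IsZero X.obj := by
  constructor
  · intro h
    refine (IsZero.iff_id_eq_zero _).2 ?_
    exact congrArg (fun f : X ⟶ X => f.hom) ((IsZero.iff_id_eq_zero X).1 h)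
  · intro h
    refine (IsZero.iff_id_eq_zero _).2 ?_
    ext
    exact (IsZero.iff_id_eq_zero X.obj).1 h

/-- A functor to a category with zero morphisms is zero exactly if all its values are. -/
lemma isZero_functor_iff {C : Type u} [Category.{v} C] {D : Type u'} [Category.{v'} D]
    [HasZeroMorphisms D] (F : C ⥤ D) : IsZero F ↔ ∀ X, IsZero (F.obj X) :=
  ⟨fun h X => (IsZero.iff_id_eq_zero _).2 (NatTrans.congr_app (h.eq_of_src (𝟙 F) 0) X),
    F.isZero⟩

lemma isZero_shift_iff {C : Type u} [Category.{v} C] [HasShift C ℤ] [Preadditive C]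
    [∀ n : ℤ, (shiftFunctor C n).Additive] (X : C) (n : ℤ) : IsZero (X⟦n⟧) ↔ IsZero X :=
  ⟨fun h => ((shiftFunctor C (-n)).map_isZero h).of_iso ((shiftEquiv C n).unitIso.app X),
    fun h => (shiftFunctor C n).map_isZero h⟩

section Exactness

variable {C : Type u} [Category.{v} C] [HasZeroObject C] [HasShift C ℤ] [Preadditive C]
  [∀ n : ℤ, (shiftFunctor C n).Additive] [Pretriangulated C]

/-- A nonzero object which is bounded has a top degree: its truncation to that degree is
nonzero. -/
lemma exists_top_truncation (t : TStructure C) {X : C} (hX : t.bounded X) (h : ¬ IsZero X) :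
    ∃ (n : ℤ) (U V : C) (f : U ⟶ X) (g : X ⟶ V) (w : V ⟶ U⟦(1 : ℤ)⟧),
      Triangle.mk f g w ∈ distTriang C ∧ t.le (n - 1) U ∧ t.le n V ∧ t.ge n V ∧ ¬ IsZero V := by
  obtain ⟨⟨a, ha⟩, ⟨b, hb⟩⟩ := hX
  -- If every such truncation vanished, the upper bound on `X` could be lowered indefinitely,
  -- eventually past the lower bound `a`.
  by_contra! hcon
  have step (n : ℤ) (hn : t.le n X) : t.le (n - 1) X := by
    obtain ⟨U, V, hU, hV, f, g, w, hT⟩ := t.exists_triangle X (n - 1) n (by lia)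
    have hVn : t.le n V := le_third t hT n (t.le_monotone (by lia) _ hU) hn
    have := (Triangle.isZero₃_iff_isIso₁ _ hT).1 (hcon n U V f g w hT hU hVn hV)
    exact (t.le (n - 1)).prop_of_iso (@asIso _ _ _ _ f this) hU
  have descend (k : ℕ) : t.le (b - k) X := by
    induction k with
    | zero => simpa using hb.le
    | succ k ih =>
      have := step _ ih
      rwa [show b - ((k + 1 : ℕ) : ℤ) = b - k - 1 by push_cast; ring]
  -- From `b`, `b - a + 1` steps reach `a - 1`; if that number is negative, `toNat` gives no steps
  -- and `b` is already below `a - 1`.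
  have : t.IsLE X (a - 1) := ⟨t.le_monotone (by lia) _ (descend (b - a + 1).toNat)⟩
  have : t.IsGE X a := ⟨ha.ge⟩
  exact h (t.isZero X (a - 1) a)

end Exactness

variable {T : Type u} [Category.{v} T] [HasZeroObject T] [HasShift T ℤ] [Preadditive T]
  [∀ n : ℤ, (shiftFunctor T n).Additive] [Pretriangulated T] [MonoidalCategory T]
  {K : Type u'} [Category.{v'} K] [HasZeroObject K] [HasShift K ℤ] [Preadditive K]
  [∀ n : ℤ, (shiftFunctor K n).Additive] [Pretriangulated K] [MonoidalLeftAction T K]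
  [IsTriangulatedModule T K] {t : TStructure T} {t' : TStructure K}

/-- If a nonzero bounded object annihilates the heart of the module category, so does some nonzero
object of the acting heart, namely its top cohomology. -/
lemma exists_heart_annihilator (h0' : (0 : ℤ) ∈ moduleDev t t') {X : T} (hb : t.bounded X)
    (hX : ¬ IsZero X) (hann : ∀ M : K, t'.heart M → IsZero (X ⊙ₗ M)) :
    ∃ Y : T, t.heart Y ∧ ¬ IsZero Y ∧ ∀ M : K, t'.heart M → IsZero (Y ⊙ₗ M) := by
  obtain ⟨n, U, V, f, g, w, hT, hU, hV, hV', hV0⟩ := exists_top_truncation t hb hX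
  refine ⟨V⟦n⟧, ⟨t.le_shift n n 0 (by lia) V hV, t.ge_shift n n 0 (by lia) V hV'⟩,
    by rwa [isZero_shift_iff], fun M hM => ?_⟩
  have hF : IsExact (actionRight T M) := IsTriangulatedModule.exact_actionRight M
  obtain ⟨w', hT'⟩ := hF.map_triangle hT
  -- The deviation condition only treats degree `0` in the acting variable; exactness of `- ⊙ₗ M`
  -- carries it to other degrees by shifting.
  have hUM : t'.le (n - 1) (U ⊙ₗ M) := by
    simpa using hF.le_add t t' (a := 0) (b := 0) (fun Z hZ => h0'.1 Z M hZ hM.1)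
      (n - 1) U (by simpa using hU)
  have hVM : t'.ge n (V ⊙ₗ M) := by
    simpa using hF.ge_add t t' (a := 0) (b := 0) (fun Z hZ => h0'.2 Z M hZ hM.2)
      n V (by simpa using hV')
  -- A zero object satisfies every bound; `n - 1` is chosen to contradict the lower bound `n` on `V
  -- ⊙ₗ M`.
  have hXM : t'.IsLE (X ⊙ₗ M) (n - 1) := t'.isLE_of_isZero (hann M hM) _
  have : t'.IsLE (V ⊙ₗ M) (n - 1) :=
    ⟨le_third t' hT' (n - 1) (t'.le_monotone (by lia) _ hUM) hXM.le⟩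
  have : t'.IsGE (V ⊙ₗ M) n := ⟨hVM⟩
  obtain ⟨e⟩ := hF.map_shift V n
  exact ((isZero_shift_iff _ n).2 (t'.isZero (V ⊙ₗ M) (n - 1) n)).of_iso e

end TriangModule

theorem proposition3p9
    {T : Type*} [Category* T] [HasZeroObject T] [HasShift T ℤ] [Preadditive T]
    [∀ n : ℤ, (shiftFunctor T n).Additive] [Pretriangulated T] [IsTriangulated T]
    [MonoidalCategory T] [TriangModule.IsMonoidalTriangulated T]
    {K : Type*} [Category* K] [HasZeroObject K] [HasShift K ℤ] [Preadditive K]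
    [∀ n : ℤ, (shiftFunctor K n).Additive] [Pretriangulated K] [IsTriangulated K]
    [MonoidalLeftAction T K] [TriangModule.IsTriangulatedModule T K]
    (t : TStructure T) (ht : TriangModule.IsMonoidalTStructure t)
    (h0 : (0 : ℤ) ∈ TriangModule.dev t)
    (t' : TStructure K) (ht' : TriangModule.IsModuleTStructure t t')
    (h0' : (0 : ℤ) ∈ TriangModule.moduleDev t t') :
    TriangModule.IsFaithfulModuleCategory T K ↔
      (haveI : t.heart.IsMonoidal := TriangModule.heart_isMonoidal ht h0
       letI : MonoidalLeftAction t.heart.FullSubcategory t'.heart.FullSubcategory :=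
        TriangModule.heartAction h0'
       TriangModule.IsFaithfulModuleCategory t.heart.FullSubcategory t'.heart.FullSubcategory) := by
  constructor
  · intro hfaith X hX hzero
    rw [TriangModule.isZero_fullSubcategory_iff] at hX
    refine hfaith X.obj hX ((TriangModule.isZero_functor_iff _).2 ?_)
    -- Boundedness of `t'` reduces vanishing on `K` to vanishing on its heart, which is `hzero`.
    refine (TriangModule.IsTriangulatedModule.exact_actionLeft X.obj).isZero_of_heart t'
      ht'.bounded fun M hM => ?_
    exact (TriangModule.isZero_fullSubcategory_iff _ _).1
      ((TriangModule.isZero_functor_iff _).1 hzero ⟨M, hM⟩)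
  · intro hfaith X hX hzero
    -- Only the action of `X` on the heart of `t'` matters here, though `hzero` covers all of `K`.
    obtain ⟨Y, hY, hY0, hann⟩ := TriangModule.exists_heart_annihilator h0' (ht.bounded X) hX
      fun M _ => (TriangModule.isZero_functor_iff _).1 hzero M
    refine hfaith ⟨Y, hY⟩ (by rwa [TriangModule.isZero_fullSubcategory_iff])
      ((TriangModule.isZero_functor_iff _).2 fun M => ?_)
    exact (TriangModule.isZero_fullSubcategory_iff _ _).2 (hann M.obj M.property)
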